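/- A $d$-dimensional $m_1\times\cdots\times m_d$ zero-one matrix $A$ contains a $d$-dimensional zero-one matrix $P$ if some submatrix of $A$ (obtained by selecting some values of each coordinate, kept in order) can be turned into $P$ by changing some (possibly no) ones to zeros; otherwise $A$ avoids $P$. Let $f(n,P,d)$ be the maximum number of ones in a $d$-dimensional $n\times\cdots\times n$ zero-one matrix that avoids $P$. A $d$-dimensional $k\times\cdots\times k$ zero-one matrix is a permutation matrix if, for every $\ell\in\{1,\dots,d\}$ and $c\in\{1,\dots,k\}$, exactly one of its ones has $\ell$-th coordinate $c$. A $j$-tuple permutation matrix generated by a permutation matrix $P$ is a Kronecker product $P\otimes R$ (each one of $P$ is replaced by a copy of $R$, each zero by a zero matrix of the size of $R$), where $R$ is an all-ones $k_1\times\cdots\times k_d$ matrix, one of $k_1,\dots,k_d$ equals $j$ and the others equal $1$. Let $$F(n,j,k,d)=\max_M f(n,M,d),$$ where $M$ ranges over all $d$-dimensional $j$-tuple permutation matrices generated by $d$-dimensional $k\times\cdots\times k$ permutation matrices. **Theorem.** Let $j\ge 2$, $k\ge 1$ and $d\ge 1$ be fixed integers. As $n\to\infty$, $$F(n,j,k,d)=\Theta(n^{d-1}).$$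 Hence $f(n,M,d)=\Theta(n^{d-1})$ for every $d$-dimensional $j$-tuple permutation matrix $M$ generated by a $k\times\cdots\times k$ permutation matrix; this is the lowest possible order, since $f(n,N,d)\ge n^{d-1}$ for all $n\ge 1$ and every $d$-dimensional zero-one matrix $N$ with at least two ones. -/

import Mathlib

open scoped Asymptotics

namespace ZeroOne

/-- A `d`-dimensional `m₁ × ⋯ × m_d` zero-one matrix (`true` is the entry `1`, `false` the
entry `0`); coordinates are numbered from `0`. -/
abbrev Mat {d : ℕ} (m : Fin d → ℕ) : Type := ((l : Fin d) → Fin (m l)) → Bool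

/-- A `d`-dimensional `n × ⋯ × n` zero-one matrix. -/
abbrev Cube (n d : ℕ) : Type := Mat (fun _ : Fin d => n)

/-- The number of ones of a zero-one matrix. -/
def ones {d : ℕ} {m : Fin d → ℕ} (A : Mat m) : ℕ :=
  (Finset.univ.filter (fun i => A i = true)).card

/-- `A` contains `P`: some submatrix of `A`, obtained by choosing (in increasing order) some values
of each coordinate, has the size of `P` and has a one wherever `P` has a one. -/
def Contains {d : ℕ} {m p : Fin d → ℕ} (A : Mat m) (P : Mat p) : Prop :=
  ∃ e : (l : Fin d) → (Fin (p l) ↪o Fin (m l)),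
    ∀ i : (l : Fin d) → Fin (p l), P i = true → A (fun l => e l (i l)) = true

/-- `A` avoids `P`. -/
def Avoids {d : ℕ} {m p : Fin d → ℕ} (A : Mat m) (P : Mat p) : Prop := ¬ Contains A P

open Classical in
/-- The extremal function `f(n, P, d)`: the maximum number of ones in a `d`-dimensional
`n × ⋯ × n` zero-one matrix that avoids `P`. -/
noncomputable def extremal (n : ℕ) {d : ℕ} {p : Fin d → ℕ} (P : Mat p) : ℕ :=
  (Finset.univ.filter (fun A : Cube n d => Avoids A P)).sup ones

/-- A `k × ⋯ × k` zero-one matrix is a permutation matrix if each of its `l`-cross sections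
(all entries whose `l`-th coordinate has a given value) contains exactly one `1`. -/
def IsPermutation {k d : ℕ} (P : Cube k d) : Prop :=
  ∀ (l : Fin d) (c : Fin k), ∃! i : Fin d → Fin k, i l = c ∧ P i = true

/-- The Kronecker product: each one of `M` is replaced by a copy of `N`, each zero of `M` by a
zero matrix of the size of `N`. -/
def kron {d : ℕ} {m n : Fin d → ℕ} (M : Mat m) (N : Mat n) : Mat (fun l => m l * n l) :=
  fun i => M (fun l => (i l).divNat) && N (fun l => (i l).modNat)

/-- The `m₁ × ⋯ × m_d` matrix of all ones. -/
def allOnes {d : ℕ} (m : Fin d → ℕ) : Mat m := fun _ => true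

/-- The size vector `(1, …, 1, j, 1, …, 1)` with `j` at position `l`. -/
def tupleSize {d : ℕ} (j : ℕ) (l : Fin d) : Fin d → ℕ := fun i => if i = l then j else 1

/-- The `j`-tuple permutation matrix generated by `P` in direction `l`: the Kronecker product of
`P` with the `1 × ⋯ × 1 × j × 1 × ⋯ × 1` matrix of all ones. As `l` varies, these are all the
`j`-tuple permutation matrices generated by the permutation matrix `P`. -/
def tupleMat {k d : ℕ} (P : Cube k d) (j : ℕ) (l : Fin d) : Mat (fun i => k * tupleSize j l i) :=
  kron P (allOnes (tupleSize j l))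

open Classical in
/-- `F(n, j, k, d)`: the maximum of `f(n, M, d)` over all `d`-dimensional `j`-tuple permutation
matrices `M` generated by `k × ⋯ × k` permutation matrices. -/
noncomputable def maxExtremal (n j k d : ℕ) : ℕ :=
  (Finset.univ.filter (fun x : Cube k d × Fin d => IsPermutation x.1)).sup
    (fun x => extremal n (tupleMat x.1 j x.2))

end ZeroOne

/-! Fix the direction `l` of the `j`-fold blow-up and cut the ones of each line in that direction
into runs of `j`, losing at most `j` ones per line. A run becomes an interval, and a matrix avoiding
`M` gives a system of intervals, disjoint on each line, in which no `k` intervals are ordered like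
the ones of `P`. It remains to show that such a system with `D` transversal directions has `O(n ^
D)` members (`exists_card_system_le`), by induction on `D`.

Contract by `s = (k + 2) ^ 2`. In each block of lines a greedy scan (`exists_disjoint_and_windows`)
leaves intervals that are disjoint even at scale `s`, hence a contracted system avoiding the same
pattern, and disjoint thick windows. A window is thick if its intervals take `k` residues in one
transversal direction or `k` of them share a line and a cell. Fixing these data supplies one
direction of the pattern for free, so the windows fall into `O(n)` classes, each bounded by the case
of one dimension less. For the maximal size `g` this gives `g (s * N) ≤ c * g N + O(N ^ D)` with `c
< s ^ D`, hence `g n = O(n ^ D)`.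

For the lower bound, a hyperplane of ones orthogonal to a direction in which two ones of `N` differ
avoids `N`. -/

namespace ZeroOne

/-! ### Greedy selection of intervals on a line -/

/-- The intervals `[a e, b e]`, for `e` in `F`, are pairwise disjoint. -/
def DisjointIntervals {ι : Type*} (a b : ι → ℕ) (F : Finset ι) : Prop :=
  ∀ e ∈ F, ∀ e' ∈ F, e ≠ e' → b e < a e' ∨ b e' < a e

/-- Greedy decomposition of a family of intervals: the members are covered by a disjoint subfamily
and by windows whose contents are thick. -/
theorem exists_disjoint_and_windows {ι : Type*} [DecidableEq ι] (a b : ι → ℕ)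
    (thick : Finset ι → Prop) (n c M : ℕ) (F : Finset ι)
    (hab : ∀ e ∈ F, a e ≤ b e) (hbn : ∀ e ∈ F, b e < n)
    (hthin : ∀ H ⊆ F, ¬ thick H →
      ∃ Q ⊆ H, DisjointIntervals a b Q ∧ H.card ≤ c * Q.card)
    (htouch : ∀ t, (F.filter (fun e => a e ≤ t ∧ t ≤ b e)).card ≤ M) :
    ∃ Q ⊆ F, ∃ W : Finset (ℕ × ℕ), DisjointIntervals a b Q ∧
      DisjointIntervals Prod.fst Prod.snd W ∧
      (∀ w ∈ W, w.1 ≤ w.2 ∧ w.2 < n ∧ thick (F.filter (fun e => w.1 ≤ a e ∧ b e ≤ w.2))) ∧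
      F.card ≤ c * Q.card + M * W.card := by
  classical
  suffices key : ∀ m u, n ≤ u + m → ∀ G ⊆ F, (∀ e, e ∈ G ↔ e ∈ F ∧ u ≤ a e) →
      ∃ Q ⊆ G, ∃ W : Finset (ℕ × ℕ), DisjointIntervals a b Q ∧
      DisjointIntervals Prod.fst Prod.snd W ∧
      (∀ w ∈ W, u ≤ w.1 ∧ w.1 ≤ w.2 ∧ w.2 < n ∧
        thick (F.filter (fun e => w.1 ≤ a e ∧ b e ≤ w.2))) ∧
      G.card ≤ c * Q.card + M * W.card by
    obtain ⟨Q, hQ, W, h1, h2, h3, h4⟩ := key n 0 (by omega) F subset_rfl (by simp)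
    exact ⟨Q, hQ, W, h1, h2, fun w hw => (h3 w hw).2, h4⟩
  intro m
  induction m using Nat.strong_induction_on with
  | _ m ih =>
  intro u hu G hGF hG
  by_cases hth : thick G
  swap
  · obtain ⟨Q, hQ, hd, hc⟩ := hthin G hGF hth
    exact ⟨Q, hQ, ∅, hd, by simp [DisjointIntervals], by simp, by simpa using hc⟩
  -- The predicate `thick` is arbitrary and may hold of the empty family.
  by_cases hne : G = ∅
  · subst hne
    exact ⟨∅, by simp, ∅, by simp [DisjointIntervals], by simp [DisjointIntervals], by simp,
      by simp⟩
  obtain ⟨e₀, he₀⟩ := Finset.nonempty_iff_ne_empty.mpr hne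
  have hun : u < n := by
    have h1 := ((hG e₀).1 he₀).2
    have h2 := hab e₀ (hGF he₀)
    have h3 := hbn e₀ (hGF he₀)
    omega
  have hex : ∃ T, u ≤ T ∧ thick (G.filter (fun e => b e ≤ T)) := by
    refine ⟨n - 1, by omega, ?_⟩
    rwa [Finset.filter_true_of_mem]
    intro e he
    have := hbn e (hGF he)
    omega
  -- `T` is the first place where the members starting from `u` and already finished become thick.
  -- The next window is `(u, T)`, and the scan resumes at `T + 1`.
  set T := Nat.find hex with hT
  obtain ⟨huT, hTthick⟩ := Nat.find_spec hex
  rw [← hT] at huT hTthick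
  have hTn : T < n := by
    have : T ≤ n - 1 := Nat.find_min' hex ⟨by omega, by
      rwa [Finset.filter_true_of_mem]
      intro e he
      have := hbn e (hGF he)
      omega⟩
    omega
  have hlow : ∃ Q ⊆ G.filter (fun e => b e < T), DisjointIntervals a b Q ∧
      (G.filter (fun e => b e < T)).card ≤ c * Q.card := by
    -- Minimality of `T` says nothing about `u - 1`, but no member of `G` ends before `u`.
    by_cases hTu : T = u
    · refine ⟨∅, by simp, by simp [DisjointIntervals], ?_⟩
      rw [Finset.filter_false_of_mem]
      · simp
      · intro e he
        have h1 := ((hG e).1 he).2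
        have h2 := hab e (hGF he)
        omega
    · apply hthin _ ((Finset.filter_subset _ _).trans hGF)
      intro hbad
      have hlt : T - 1 < T := by omega
      apply Nat.find_min hex hlt
      refine ⟨by omega, ?_⟩
      convert hbad using 3
      omega
  obtain ⟨Q₁, hQ₁, hd₁, hc₁⟩ := hlow
  obtain ⟨Q₂, hQ₂, W, hd₂, hdW, hW, hc₂⟩ := ih (n - (T + 1)) (by omega) (T + 1) (by omega)
    (G.filter (fun e => T + 1 ≤ a e)) ((Finset.filter_subset _ _).trans hGF) (by
      intro e
      rw [Finset.mem_filter, hG]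
      constructor
      · rintro ⟨⟨h1, _⟩, h2⟩; exact ⟨h1, h2⟩
      · rintro ⟨h1, h2⟩; exact ⟨⟨h1, by omega⟩, h2⟩)
  have hQ₁' : ∀ e ∈ Q₁, e ∈ G ∧ b e < T := fun e he => by simpa using hQ₁ he
  have hQ₂' : ∀ e ∈ Q₂, e ∈ G ∧ T + 1 ≤ a e := fun e he => by simpa using hQ₂ he
  have hnot : (u, T) ∉ W := fun h => by
    have := (hW _ h).1
    simp only at this
    omega
  have hdisj : Disjoint Q₁ Q₂ := by
    rw [Finset.disjoint_left]
    intro e h1 h2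
    have := (hQ₁' e h1).2
    have := (hQ₂' e h2).2
    have := hab e (hGF (hQ₁' e h1).1)
    omega
  refine ⟨Q₁ ∪ Q₂, ?_, insert (u, T) W, ?_, ?_, ?_, ?_⟩
  · intro e he
    rcases Finset.mem_union.1 he with h | h
    · exact (hQ₁' e h).1
    · exact (hQ₂' e h).1
  · intro e he e' he' hee
    rcases Finset.mem_union.1 he with h | h <;> rcases Finset.mem_union.1 he' with h' | h'
    · exact hd₁ e h e' h' hee
    · left
      have := (hQ₁' e h).2
      have := (hQ₂' e' h').2
      omega
    · right
      have := (hQ₁' e' h').2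
      have := (hQ₂' e h).2
      omega
    · exact hd₂ e h e' h' hee
  · intro w hw w' hw' hne
    rcases Finset.mem_insert.1 hw with rfl | h <;> rcases Finset.mem_insert.1 hw' with rfl | h'
    · exact absurd rfl hne
    · left
      have := (hW _ h').1
      simp only
      omega
    · right
      have := (hW _ h).1
      simp only
      omega
    · exact hdW w h w' h' hne
  · intro w hw
    rcases Finset.mem_insert.1 hw with rfl | h
    · refine ⟨le_rfl, huT, hTn, ?_⟩
      convert hTthick using 1
      ext e
      simp only [Finset.mem_filter, hG]
      tauto
    · obtain ⟨h1, h2, h3, h4⟩ := hW w h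
      exact ⟨by omega, h2, h3, h4⟩
  · rw [Finset.card_union_of_disjoint hdisj, Finset.card_insert_of_notMem hnot]
    -- Members ending before `T` are thin, those starting after `T` are handled recursively, and at
    -- most `M` others contain `T`; the window `(u, T)` pays for these.
    have hcov : G ⊆ (G.filter (fun e => b e < T) ∪ G.filter (fun e => T + 1 ≤ a e)) ∪
        F.filter (fun e => a e ≤ T ∧ T ≤ b e) := by
      intro e he
      have := hGF he
      simp only [Finset.mem_union, Finset.mem_filter]
      rcases lt_or_ge (b e) T with h | h
      · tauto
      · rcases Nat.lt_or_ge T (a e) with h' | h'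
        · left; right; exact ⟨he, h'⟩
        · tauto
    have h1 := Finset.card_le_card hcov
    have h2 := Finset.card_union_le
      (G.filter (fun e => b e < T) ∪ G.filter (fun e => T + 1 ≤ a e))
      (F.filter (fun e => a e ≤ T ∧ T ≤ b e))
    have h3 := Finset.card_union_le (G.filter (fun e => b e < T))
      (G.filter (fun e => T + 1 ≤ a e))
    have h4 := htouch T
    nlinarith

/-- If no point lies in more than `M` of the intervals, then a proportion `1 / M` of them is
pairwise disjoint. -/
theorem exists_disjoint_of_touch {ι : Type*} [DecidableEq ι] (a b : ι → ℕ) (M : ℕ) (F : Finset ι)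
    (hab : ∀ e ∈ F, a e ≤ b e)
    (htouch : ∀ t, (F.filter (fun e => a e ≤ t ∧ t ≤ b e)).card ≤ M) :
    ∃ Q ⊆ F, DisjointIntervals a b Q ∧ F.card ≤ M * Q.card := by
  classical
  rcases F.eq_empty_or_nonempty with rfl | ⟨e₀, -⟩
  · exact ⟨∅, by simp, by simp [DisjointIntervals], by simp⟩
  have : Nonempty ι := ⟨e₀⟩
  -- With nonemptiness as thickness, thin families are empty, so `c = 0` works; one member from each
  -- window gives the disjoint family.
  obtain ⟨_, _, W, _, hdW, hW, hc⟩ := exists_disjoint_and_windows a b Finset.Nonempty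
    (F.sup b + 1) 0 M F hab (fun e he => Nat.lt_succ_of_le (Finset.le_sup he)) (by
      intro H _ hne
      rw [Finset.not_nonempty_iff_eq_empty] at hne
      subst hne
      exact ⟨∅, by simp, by simp [DisjointIntervals], by simp⟩) htouch
  choose! g hg using fun w hw => (hW w hw).2.2
  simp only [Finset.mem_filter] at hg
  have hinj : Set.InjOn g W := by
    intro w hw w' hw' h
    by_contra hne
    have h1 := hg w hw
    have h2 := hg w' hw'
    rw [h] at h1
    have := hab _ h2.1
    rcases hdW w hw w' hw' hne with h | h <;> omega
  refine ⟨W.image g, ?_, ?_, ?_⟩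
  · intro e he
    obtain ⟨w, hw, rfl⟩ := Finset.mem_image.1 he
    exact (hg w hw).1
  · intro e he e' he' hne
    obtain ⟨w, hw, rfl⟩ := Finset.mem_image.1 he
    obtain ⟨w', hw', rfl⟩ := Finset.mem_image.1 he'
    have h1 := hg w hw
    have h2 := hg w' hw'
    rcases hdW w hw w' hw' (fun h => hne (by rw [h])) with h | h
    · left; omega
    · right; omega
  · rw [Finset.card_image_of_injOn hinj]
    simpa using hc

/-! ### Interval systems and thick families -/

/-- An interval `[a, b]` on the line with transversal coordinates `x`, encoded as `(x, a, b)`. -/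
abbrev Item (D : ℕ) : Type := (Fin D → ℕ) × ℕ × ℕ

/-- A family of intervals inside the cube `[0, n)^(D+1)`, disjoint on each line. -/
structure IsSystem {D : ℕ} (n : ℕ) (S : Finset (Item D)) : Prop where
  lt : ∀ e ∈ S, ∀ i, e.1 i < n
  le : ∀ e ∈ S, e.2.1 ≤ e.2.2
  snd_lt : ∀ e ∈ S, e.2.2 < n
  disj : ∀ e ∈ S, ∀ e' ∈ S, e ≠ e' → e.1 = e'.1 → e.2.2 < e'.2.1 ∨ e'.2.2 < e.2.1

/-- The system contains `k` intervals in the relative position given by the permutations `σ`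
(transversal coordinates) and `τ` (along the lines). -/
def HasPattern {D k : ℕ} (S : Finset (Item D)) (σ : Fin D → Equiv.Perm (Fin k))
    (τ : Equiv.Perm (Fin k)) : Prop :=
  ∃ f : Fin k → Item D, (∀ r, f r ∈ S) ∧
    (∀ i r r', σ i r < σ i r' → (f r).1 i < (f r').1 i) ∧
    ∀ r r', τ r < τ r' → (f r).2.2 < (f r').2.1

theorem IsSystem.subset {D n : ℕ} {S T : Finset (Item D)} (hS : IsSystem n S) (h : T ⊆ S) :
    IsSystem n T :=
  ⟨fun e he => hS.lt e (h he), fun e he => hS.le e (h he), fun e he => hS.snd_lt e (h he),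
    fun e he e' he' => hS.disj e (h he) e' (h he')⟩

/-- A family of intervals in a block is thick if its members have `k` different positions in some
transversal direction, or if `k` of them lie on one line and in one cell of length `s`. -/
def Thick {D : ℕ} (k s : ℕ) (H : Finset (Item D)) : Prop :=
  (∃ i, k ≤ (H.image (fun e => e.1 i % s)).card) ∨
    ∃ x t, k ≤ (H.filter (fun e => e.1 = x ∧ e.2.1 / s = t ∧ e.2.2 / s = t)).card

/-- On one line, all but two of the intervals that meet a cell lie inside it. -/
theorem card_touch_line_le {D n s : ℕ} (hs : 0 < s) {F : Finset (Item D)} (hF : IsSystem n F)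
    (x : Fin D → ℕ) (t : ℕ) :
    (F.filter (fun e => e.1 = x ∧ e.2.1 / s ≤ t ∧ t ≤ e.2.2 / s)).card ≤
      (F.filter (fun e => e.1 = x ∧ e.2.1 / s = t ∧ e.2.2 / s = t)).card + 2 := by
  classical
  have hpt : ∀ p, (F.filter (fun e => e.1 = x ∧ e.2.1 ≤ p ∧ p ≤ e.2.2)).card ≤ 1 := by
    intro p
    rw [Finset.card_le_one]
    intro e he e' he'
    simp only [Finset.mem_filter] at he he'
    by_contra hne
    rcases hF.disj e he.1 e' he'.1 hne (he.2.1.trans he'.2.1.symm) with h | h <;> omega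
  -- An interval that meets the cell without lying inside it contains the cell's first or last
  -- point.
  have hcov : F.filter (fun e => e.1 = x ∧ e.2.1 / s ≤ t ∧ t ≤ e.2.2 / s) ⊆
      (F.filter (fun e => e.1 = x ∧ e.2.1 / s = t ∧ e.2.2 / s = t) ∪
        F.filter (fun e => e.1 = x ∧ e.2.1 ≤ t * s ∧ t * s ≤ e.2.2)) ∪
        F.filter (fun e => e.1 = x ∧ e.2.1 ≤ t * s + (s - 1) ∧ t * s + (s - 1) ≤ e.2.2) := by
    intro e he
    simp only [Finset.mem_union, Finset.mem_filter] at he ⊢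
    obtain ⟨heF, hx, h1, h2⟩ := he
    have h3 := (Nat.le_div_iff_mul_le hs).1 h2
    have h4 := (Nat.div_lt_iff_lt_mul hs).1 (Nat.lt_succ_of_le h1)
    have h4' : e.2.1 < t * s + s := by rw [Nat.succ_mul] at h4; exact h4
    by_cases hc : e.2.1 / s = t ∧ e.2.2 / s = t
    · exact Or.inl (Or.inl ⟨heF, hx, hc⟩)
    · by_cases h5 : e.2.1 ≤ t * s
      · exact Or.inl (Or.inr ⟨heF, hx, h5, h3⟩)
      · refine Or.inr ⟨heF, hx, by omega, ?_⟩
        by_contra h6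
        apply hc
        have hle := hF.le e heF
        constructor
        · apply le_antisymm h1
          rw [Nat.le_div_iff_mul_le hs]; omega
        · apply le_antisymm _ h2
          apply Nat.le_of_lt_succ
          rw [Nat.div_lt_iff_lt_mul hs, Nat.succ_mul]; omega
  have h1 := Finset.card_le_card hcov
  have h2 := Finset.card_union_le
    (F.filter (fun e => e.1 = x ∧ e.2.1 / s = t ∧ e.2.2 / s = t) ∪
        F.filter (fun e => e.1 = x ∧ e.2.1 ≤ t * s ∧ t * s ≤ e.2.2))
    (F.filter (fun e => e.1 = x ∧ e.2.1 ≤ t * s + (s - 1) ∧ t * s + (s - 1) ≤ e.2.2))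
  have h3 := Finset.card_union_le (F.filter (fun e => e.1 = x ∧ e.2.1 / s = t ∧ e.2.2 / s = t))
        (F.filter (fun e => e.1 = x ∧ e.2.1 ≤ t * s ∧ t * s ≤ e.2.2))
  have h4 := hpt (t * s)
  have h5 := hpt (t * s + (s - 1))
  omega

/-- Disjoint intervals have distinct left endpoints, and a cell has `s` points. -/
theorem card_cell_line_le {D n s : ℕ} (hs : 0 < s) {F : Finset (Item D)} (hF : IsSystem n F)
    (x : Fin D → ℕ) (t : ℕ) :
    (F.filter (fun e => e.1 = x ∧ e.2.1 / s = t ∧ e.2.2 / s = t)).card ≤ s := by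
  classical
  calc _ ≤ (Finset.Ico (t * s) (t * s + s)).card := by
        apply Finset.card_le_card_of_injOn (fun e => e.2.1)
        · intro e he
          simp only [Finset.coe_filter, Set.mem_ofPred_eq] at he
          obtain ⟨_, _, h, _⟩ := he
          have h1 := (Nat.le_div_iff_mul_le hs).1 h.ge
          have h2 := (Nat.div_lt_iff_lt_mul hs).1 (Nat.lt_succ_of_le h.le)
          rw [Nat.succ_mul] at h2
          simpa using ⟨h1, h2⟩
        · intro e he e' he' h
          simp only [Finset.coe_filter, Set.mem_ofPred_eq] at he he' h
          by_contra hne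
          have := hF.le e he.1
          have := hF.le e' he'.1
          rcases hF.disj e he.1 e' he'.1 hne (he.2.1.trans he'.2.1.symm) with h | h <;> omega
    _ = s := by simp

/-- Counting intervals that meet a cell, from the number of lines and a bound per line. -/
theorem card_touch_le {D n s L B : ℕ} (hs : 0 < s) {X : Fin D → ℕ} {F : Finset (Item D)}
    (hF : IsSystem n F) (hX : ∀ e ∈ F, ∀ i, e.1 i / s = X i) (t : ℕ)
    (hL : ∀ i, (F.image (fun e => e.1 i % s)).card ≤ L)
    (hB : ∀ x, (F.filter (fun e => e.1 = x ∧ e.2.1 / s = t ∧ e.2.2 / s = t)).card ≤ B) :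
    (F.filter (fun e => e.2.1 / s ≤ t ∧ t ≤ e.2.2 / s)).card ≤ L ^ D * (B + 2) := by
  classical
  -- Within one block a line is determined by its residues modulo `s`.
  have hlines : (F.image Prod.fst).card ≤ L ^ D := by
    calc _ ≤ (Fintype.piFinset (fun i => F.image (fun e => e.1 i % s))).card := by
          apply Finset.card_le_card_of_injOn (fun x i => x i % s)
          · intro x hx
            obtain ⟨e, he, rfl⟩ := Finset.mem_image.1 hx
            simp only [Fintype.coe_piFinset, Set.mem_univ_pi, Finset.coe_image]
            exact fun i => ⟨e, he, rfl⟩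
          · intro x hx y hy h
            obtain ⟨e, he, rfl⟩ := Finset.mem_image.1 hx
            obtain ⟨e', he', rfl⟩ := Finset.mem_image.1 hy
            ext i
            have h1 := congrFun h i
            simp only at h1
            rw [← Nat.div_add_mod (e.1 i) s, ← Nat.div_add_mod (e'.1 i) s, hX e he, hX e' he', h1]
      _ = ∏ i, (F.image (fun e => e.1 i % s)).card := Fintype.card_piFinset _
      _ ≤ ∏ _i : Fin D, L := Finset.prod_le_prod' fun i _ => hL i
      _ = L ^ D := by simp
  calc _ ≤ (B + 2) * (F.image Prod.fst).card := by
        apply Finset.card_le_mul_card_image_of_maps_to (f := Prod.fst)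
        · intro e he
          exact Finset.mem_image_of_mem _ (Finset.mem_filter.1 he).1
        · intro x _
          rw [Finset.filter_filter]
          refine le_trans ?_ ((card_touch_line_le hs hF x t).trans (Nat.add_le_add_right (hB x) 2))
          apply Finset.card_le_card
          intro e he
          simp only [Finset.mem_filter] at he ⊢
          tauto
    _ ≤ (B + 2) * L ^ D := Nat.mul_le_mul_left _ hlines
    _ = _ := mul_comm _ _

/-- The intervals in one block of side `s`, seen at scale `s`, are covered by a disjoint subfamily
and by windows with thick contents. -/
theorem block_windows {D n s : ℕ} (k : ℕ) (hs : 0 < s) {X : Fin D → ℕ} {F : Finset (Item D)}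
    (hF : IsSystem (s * n) F) (hX : ∀ e ∈ F, ∀ i, e.1 i / s = X i) :
    ∃ Q ⊆ F, ∃ W : Finset (ℕ × ℕ),
      DisjointIntervals (fun e : Item D => e.2.1 / s) (fun e => e.2.2 / s) Q ∧
      DisjointIntervals Prod.fst Prod.snd W ∧
      (∀ w ∈ W, w.1 ≤ w.2 ∧ w.2 < n ∧
        Thick k s (F.filter (fun e => w.1 ≤ e.2.1 / s ∧ e.2.2 / s ≤ w.2))) ∧
      F.card ≤ k ^ D * (k + 2) * Q.card + s ^ D * (s + 2) * W.card := by
  classical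
  apply exists_disjoint_and_windows
  · exact fun e he => Nat.div_le_div_right (hF.le e he)
  · exact fun e he => Nat.div_lt_of_lt_mul (hF.snd_lt e he)
  · intro H hH hthin
    simp only [Thick, not_or, not_exists, not_le] at hthin
    apply exists_disjoint_of_touch
    · exact fun e he => Nat.div_le_div_right (hF.le e (hH he))
    · exact fun t => card_touch_le hs (hF.subset hH) (fun e he => hX e (hH he)) t
        (fun i => (hthin.1 i).le) fun x => (hthin.2 x t).le
  -- Without thinness only the crude bound by `s` residues and `s` intervals per cell remains; it
  -- affects only the coefficient of `W.card`.
  · intro t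
    apply card_touch_le hs hF hX t
    · intro i
      calc _ ≤ (Finset.range s).card := Finset.card_le_card (by
            intro r hr
            obtain ⟨e, _, rfl⟩ := Finset.mem_image.1 hr
            simpa using Nat.mod_lt _ hs)
        _ = s := Finset.card_range s
    · exact fun x => card_cell_line_le hs hF x t

/-! ### Contraction by a factor `s` -/

theorem exists_strictMono_mem {k : ℕ} {A : Finset ℕ} (h : k ≤ A.card) :
    ∃ g : Fin k → ℕ, StrictMono g ∧ ∀ p, g p ∈ A := by
  obtain ⟨B, hBA, hB⟩ := Finset.exists_subset_card_eq h
  exact ⟨B.orderEmbOfFin hB, (B.orderEmbOfFin hB).strictMono,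
    fun p => hBA (B.orderEmbOfFin_mem hB p)⟩

/-- This lifts patterns found at scale `s` back to the original system. -/
theorem lt_of_div_lt_div {s x y : ℕ} (h : x / s < y / s) : x < y := by
  by_contra hle
  exact absurd (Nat.div_le_div_right (c := s) (not_lt.1 hle)) (not_le.2 h)

/-- The members of `S` that lie in the block of side `s` with index `w.1` and, at scale `s`, inside
the window `w.2`. -/
def windowItems {D : ℕ} (s : ℕ) (S : Finset (Item D)) (w : Item D) : Finset (Item D) :=
  S.filter (fun e => (∀ i, e.1 i / s = w.1 i) ∧ w.2.1 ≤ e.2.1 / s ∧ e.2.2 / s ≤ w.2.2)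

theorem mem_windowItems {D s : ℕ} {S : Finset (Item D)} {w e : Item D} :
    e ∈ windowItems s S w ↔
      e ∈ S ∧ (∀ i, e.1 i / s = w.1 i) ∧ w.2.1 ≤ e.2.1 / s ∧ e.2.2 / s ≤ w.2.2 :=
  Finset.mem_filter

/-- Contraction by `s` of a system that avoids a pattern: the contracted system avoids the pattern
too, up to an error controlled by thick windows. -/
theorem contract_system {D k n s : ℕ} (hs : 0 < s) {S : Finset (Item D)}
    (hS : IsSystem (s * n) S) {σ : Fin D → Equiv.Perm (Fin k)} {τ : Equiv.Perm (Fin k)}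
    (hno : ¬ HasPattern S σ τ) :
    ∃ S' W : Finset (Item D), IsSystem n S' ∧ ¬ HasPattern S' σ τ ∧ IsSystem n W ∧
      (∀ w ∈ W, Thick k s (windowItems s S w)) ∧
      S.card ≤ k ^ D * (k + 2) * S'.card + s ^ D * (s + 2) * W.card := by
  classical
  have hblock : ∀ X : Fin D → ℕ, ∃ Q ⊆ S.filter (fun e => (fun i => e.1 i / s) = X),
      ∃ W : Finset (ℕ × ℕ),
      DisjointIntervals (fun e : Item D => e.2.1 / s) (fun e => e.2.2 / s) Q ∧
      DisjointIntervals Prod.fst Prod.snd W ∧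
      (∀ w ∈ W, w.1 ≤ w.2 ∧ w.2 < n ∧ Thick k s ((S.filter
        (fun e => (fun i => e.1 i / s) = X)).filter
          (fun e => w.1 ≤ e.2.1 / s ∧ e.2.2 / s ≤ w.2))) ∧
      (S.filter (fun e => (fun i => e.1 i / s) = X)).card ≤
        k ^ D * (k + 2) * Q.card + s ^ D * (s + 2) * W.card := by
    intro X
    exact block_windows k hs (hS.subset (Finset.filter_subset _ S))
      fun e he i => congrFun (Finset.mem_filter.1 he).2 i
  choose Q hQF W hQd hWd hW hc using hblock
  set B : Finset (Fin D → ℕ) := S.image (fun e i => e.1 i / s) with hB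
  have hBn : ∀ X ∈ B, ∀ i, X i < n := by
    intro X hX i
    obtain ⟨e, he, rfl⟩ := Finset.mem_image.1 hX
    exact Nat.div_lt_of_lt_mul (hS.lt e he i)
  have hQ : ∀ X, ∀ e ∈ Q X, e ∈ S ∧ (fun i => e.1 i / s) = X :=
    fun X e he => Finset.mem_filter.1 (hQF X he)
  let con : Item D → Item D := fun e => (fun i => e.1 i / s, e.2.1 / s, e.2.2 / s)
  let U := B.biUnion Q
  have hU : ∀ e ∈ U, e ∈ S ∧ e ∈ Q (fun i => e.1 i / s) := by
    intro e he
    obtain ⟨X, _, h⟩ := Finset.mem_biUnion.1 he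
    have := hQ X e h
    exact ⟨this.1, by rw [this.2]; exact h⟩
  have hUdisj : ∀ e ∈ U, ∀ e' ∈ U, e ≠ e' → (con e).1 = (con e').1 →
      e.2.2 / s < e'.2.1 / s ∨ e'.2.2 / s < e.2.1 / s := by
    intro e he e' he' hne h
    have h1 := (hU e he).2
    have h2 := (hU e' he').2
    simp only [con] at h
    rw [← h] at h2
    exact hQd _ e h1 e' h2 hne
  have hinj : Set.InjOn con U := by
    intro e he e' he' h
    by_contra hne
    have h1 := Nat.div_le_div_right (c := s) (hS.le e (hU e he).1)
    have h2 := congrArg (fun z : Item D => z.2.1) h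
    have h3 := congrArg (fun z : Item D => z.2.2) h
    simp only [con] at h2 h3
    rcases hUdisj e he e' he' hne (congrArg Prod.fst h) with h | h <;> omega
  refine ⟨U.image con, B.biUnion (fun X => (W X).image (fun w => (X, w))), ?_, ?_, ?_, ?_, ?_⟩
  · constructor
    · intro e he i
      obtain ⟨u, hu, rfl⟩ := Finset.mem_image.1 he
      exact Nat.div_lt_of_lt_mul (hS.lt u (hU u hu).1 i)
    · intro e he
      obtain ⟨u, hu, rfl⟩ := Finset.mem_image.1 he
      exact Nat.div_le_div_right (hS.le u (hU u hu).1)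
    · intro e he
      obtain ⟨u, hu, rfl⟩ := Finset.mem_image.1 he
      exact Nat.div_lt_of_lt_mul (hS.snd_lt u (hU u hu).1)
    · intro e he e' he' hne h
      obtain ⟨u, hu, rfl⟩ := Finset.mem_image.1 he
      obtain ⟨u', hu', rfl⟩ := Finset.mem_image.1 he'
      exact hUdisj u hu u' hu' (fun h => hne (by rw [h])) h
  · rintro ⟨f, hf, hσ, hτ⟩
    choose g hgU hg using fun r => Finset.mem_image.1 (hf r)
    refine hno ⟨g, fun r => (hU _ (hgU r)).1, fun i r r' h => ?_, fun r r' h => ?_⟩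
    · have := hσ i r r' h
      rw [← hg r, ← hg r'] at this
      exact lt_of_div_lt_div this
    · have := hτ r r' h
      rw [← hg r, ← hg r'] at this
      exact lt_of_div_lt_div this
  · have hmem : ∀ e ∈ B.biUnion (fun X => (W X).image (fun w => (X, w))),
        e.1 ∈ B ∧ e.2 ∈ W e.1 := by
      intro e he
      simp only [Finset.mem_biUnion, Finset.mem_image] at he
      obtain ⟨X, hX, w, hw, rfl⟩ := he
      exact ⟨hX, hw⟩
    constructor
    · exact fun e he => hBn _ (hmem e he).1
    · exact fun e he => (hW _ _ (hmem e he).2).1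
    · exact fun e he => (hW _ _ (hmem e he).2).2.1
    · intro e he e' he' hne h
      have h1 := (hmem e he).2
      have h2 := (hmem e' he').2
      rw [← h] at h2
      exact hWd _ _ h1 _ h2 (fun h' => hne (Prod.ext h h'))
  · intro e he
    simp only [Finset.mem_biUnion, Finset.mem_image] at he
    obtain ⟨X, hX, w, hw, rfl⟩ := he
    have := (hW X w hw).2.2
    convert this using 1
    ext e
    simp only [mem_windowItems, Finset.mem_filter, funext_iff, and_assoc]
  · rw [Finset.card_image_of_injOn hinj, Finset.card_biUnion, Finset.card_biUnion]
    · calc S.card = ∑ X ∈ B, (S.filter (fun e => (fun i => e.1 i / s) = X)).card :=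
            Finset.card_eq_sum_card_image _ _
        _ ≤ ∑ X ∈ B, (k ^ D * (k + 2) * (Q X).card + s ^ D * (s + 2) * (W X).card) :=
            Finset.sum_le_sum fun X _ => hc X
        _ = _ := by
            rw [Finset.sum_add_distrib, Finset.mul_sum, Finset.mul_sum]
            congr 1
            refine Finset.sum_congr rfl fun X _ => ?_
            rw [Finset.card_image_of_injective _ (Prod.mk_right_injective X)]
    · intro X _ Y _ hne
      simp only [Function.onFun, Finset.disjoint_left, Finset.mem_image, not_exists, not_and]
      rintro _ ⟨w, _, rfl⟩ w' _ h
      exact hne (congrArg Prod.fst h).symm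
    · intro X _ Y _ hne
      simp only [Function.onFun, Finset.disjoint_left]
      intro e h1 h2
      exact hne ((hQ X e h1).2.symm.trans (hQ Y e h2).2)

/-! ### Counting thick windows -/

/-- The windows that are thick in direction `i`, with a common block coordinate and common
residues in that direction, form a system of dimension one less that avoids a pattern. -/
theorem card_windows_of_residues {D k n s K : ℕ} {S T : Finset (Item (D + 1))}
    {σ : Fin (D + 1) → Equiv.Perm (Fin k)} {τ : Equiv.Perm (Fin k)}
    (hno : ¬ HasPattern S σ τ) (hT : IsSystem n T) (i : Fin (D + 1))
    (hK : ∀ U : Finset (Item D), IsSystem n U → ¬ HasPattern U (i.removeNth σ) τ → U.card ≤ K)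
    (v : ℕ) (ρ : Fin k → ℕ) (hρ : StrictMono ρ)
    (hcol : ∀ w ∈ T, w.1 i = v ∧ ∀ p, ∃ e ∈ windowItems s S w, e.1 i % s = ρ p) :
    T.card ≤ K := by
  classical
  have hext : ∀ w ∈ T, ∀ w' ∈ T, i.removeNth w.1 = i.removeNth w'.1 → w.1 = w'.1 := by
    intro w hw w' hw' h
    rw [← Fin.insertNth_self_removeNth i w.1, ← Fin.insertNth_self_removeNth i w'.1, h,
      (hcol w hw).1, (hcol w' hw').1]
  have hinj : Set.InjOn (fun w : Item (D + 1) => ((i.removeNth w.1, w.2) : Item D)) T := by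
    intro w hw w' hw' h
    rw [Prod.mk.injEq] at h
    exact Prod.ext (hext w hw w' hw' h.1) h.2
  rw [← Finset.card_image_of_injOn hinj]
  apply hK
  · constructor
    · intro e he j
      obtain ⟨w, hw, rfl⟩ := Finset.mem_image.1 he
      exact hT.lt w hw _
    · intro e he
      obtain ⟨w, hw, rfl⟩ := Finset.mem_image.1 he
      exact hT.le w hw
    · intro e he
      obtain ⟨w, hw, rfl⟩ := Finset.mem_image.1 he
      exact hT.snd_lt w hw
    · intro e he e' he' hne h
      obtain ⟨w, hw, rfl⟩ := Finset.mem_image.1 he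
      obtain ⟨w', hw', rfl⟩ := Finset.mem_image.1 he'
      exact hT.disj w hw w' hw' (fun h => hne (by rw [h])) (hext w hw w' hw' h)
  · rintro ⟨f, hf, hσ, hτ⟩
    choose g hgT hg using fun r => Finset.mem_image.1 (hf r)
    -- Choosing the residue of rank `σ i r` in the `r`-th window restores the deleted direction,
    -- since the block coordinate there is common.
    choose e he hres using fun r => (hcol (g r) (hgT r)).2 (σ i r)
    simp only [mem_windowItems] at he
    refine hno ⟨e, fun r => (he r).1, fun j r r' h => ?_, fun r r' h => ?_⟩
    · rcases Fin.eq_self_or_eq_succAbove i j with rfl | ⟨j, rfl⟩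
      · have h1 := (he r).2.1 j
        have h2 := (he r').2.1 j
        rw [(hcol _ (hgT r)).1] at h1
        rw [(hcol _ (hgT r')).1] at h2
        have h3 := hρ h
        rw [← hres, ← hres] at h3
        rw [← Nat.div_add_mod ((e r).1 j) s, ← Nat.div_add_mod ((e r').1 j) s, h1, h2]
        omega
      · have := hσ j r r' h
        rw [← hg r, ← hg r'] at this
        apply lt_of_div_lt_div (s := s)
        rw [(he r).2.1, (he r').2.1]
        exact this
    · have := hτ r r' h
      rw [← hg r, ← hg r'] at this
      apply lt_of_div_lt_div (s := s)
      exact (he r).2.2.2.trans_lt (this.trans_le (he r').2.2.1)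

/-- The windows that contain one given cell, in which a line carries intervals at given places,
form a set of blocks that avoids a pattern. -/
theorem card_windows_of_cell {D k n s K : ℕ} {S T : Finset (Item (D + 1))}
    {σ : Fin (D + 1) → Equiv.Perm (Fin k)} {τ : Equiv.Perm (Fin k)}
    (hno : ¬ HasPattern S σ τ) (hT : IsSystem n T)
    (hK : ∀ U : Finset (Item D), IsSystem n U → ¬ HasPattern U (Fin.tail σ) (σ 0) → U.card ≤ K)
    (v : ℕ) (α β : Fin k → ℕ) (hαβ : ∀ p q, p < q → β p < α q)
    (hcol : ∀ w ∈ T, w.2.1 ≤ v ∧ v ≤ w.2.2 ∧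
      ∃ x : Fin (D + 1) → ℕ, (∀ i, x i / s = w.1 i) ∧ ∀ p, (x, α p, β p) ∈ S) :
    T.card ≤ K := by
  classical
  -- Windows over one block are disjoint, so at most one contains the cell `v`. Each block index is
  -- then a one-point interval in direction `0`.
  have hinj : Set.InjOn (fun w : Item (D + 1) => ((Fin.tail w.1, w.1 0, w.1 0) : Item D)) T := by
    intro w hw w' hw' h
    simp only [Prod.mk.injEq] at h
    have h1 : w.1 = w'.1 := by
      rw [← Fin.cons_self_tail w.1, ← Fin.cons_self_tail w'.1, h.1, h.2.1]
    by_contra hne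
    have h2 := hcol w hw
    have h3 := hcol w' hw'
    rcases hT.disj w hw w' hw' hne h1 with h | h <;> omega
  rw [← Finset.card_image_of_injOn hinj]
  apply hK
  · constructor
    · intro e he j
      obtain ⟨w, hw, rfl⟩ := Finset.mem_image.1 he
      exact hT.lt w hw _
    · intro e he
      obtain ⟨w, hw, rfl⟩ := Finset.mem_image.1 he
      exact le_rfl
    · intro e he
      obtain ⟨w, hw, rfl⟩ := Finset.mem_image.1 he
      exact hT.lt w hw _
    · intro e he e' he' hne h
      obtain ⟨w, hw, rfl⟩ := Finset.mem_image.1 he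
      obtain ⟨w', hw', rfl⟩ := Finset.mem_image.1 he'
      simp only at h ⊢
      apply lt_or_gt_of_ne
      intro h'
      exact hne (by simp only [h, h'])
  · rintro ⟨f, hf, hσ, hτ⟩
    choose g hgT hg using fun r => Finset.mem_image.1 (hf r)
    choose x hx hxS using fun r => (hcol (g r) (hgT r)).2.2
    -- The blocks realise `σ`; taking the interval of rank `τ r` in the `r`-th block realises `τ`.
    refine hno ⟨fun r => (x r, α (τ r), β (τ r)), fun r => hxS r _, fun j r r' h => ?_,
      fun r r' h => hαβ _ _ h⟩
    apply lt_of_div_lt_div (s := s)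
    simp only [hx]
    refine Fin.cases (fun h => ?_) (fun j h => ?_) j h
    · have := hτ r r' h
      rw [← hg r, ← hg r'] at this
      exact this
    · have := hσ j r r' h
      rw [← hg r, ← hg r'] at this
      exact this

/-- The number of thick windows is bounded in terms of the systems of dimension one less. -/
theorem card_thick_windows_le {D k n s K : ℕ} (hk : 0 < k) (hs : 0 < s)
    {S W : Finset (Item (D + 1))} {σ : Fin (D + 1) → Equiv.Perm (Fin k)} {τ : Equiv.Perm (Fin k)}
    (hS : IsSystem (s * n) S) (hno : ¬ HasPattern S σ τ) (hW : IsSystem n W)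
    (hthick : ∀ w ∈ W, Thick k s (windowItems s S w))
    (hK : ∀ i : Fin (D + 1), ∀ U : Finset (Item D), IsSystem n U →
      ¬ HasPattern U (i.removeNth σ) τ → U.card ≤ K)
    (hK' : ∀ U : Finset (Item D), IsSystem n U → ¬ HasPattern U (Fin.tail σ) (σ 0) →
      U.card ≤ K) :
    W.card ≤ K * (((D + 1) * s ^ k + (s * s) ^ k) * n) := by
  classical
  -- A colour records why a window is thick: a direction and `k` residues, or the endpoints modulo
  -- `s` of `k` intervals in one cell. The extra natural number is the block coordinate or the cell
  -- index.
  let Γ := (Fin (D + 1) × (Fin k → Fin s)) ⊕ (Fin k → Fin s × Fin s)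
  let P : Item (D + 1) → Γ × ℕ → Prop := fun w c =>
    match c.1 with
    | Sum.inl (i, ρ) => StrictMono (fun p => (ρ p : ℕ)) ∧ w.1 i = c.2 ∧
        ∀ p, ∃ e ∈ windowItems s S w, e.1 i % s = ρ p
    | Sum.inr φ => (∀ p q, p < q → c.2 * s + (φ p).2 < c.2 * s + (φ q).1) ∧
        w.2.1 ≤ c.2 ∧ c.2 ≤ w.2.2 ∧
        ∃ x : Fin (D + 1) → ℕ, (∀ i, x i / s = w.1 i) ∧
          ∀ p, (x, c.2 * s + (φ p).1, c.2 * s + (φ p).2) ∈ S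
  have hcol : ∀ w ∈ W, ∃ c : Γ × ℕ, c.2 < n ∧ P w c := by
    intro w hw
    rcases hthick w hw with ⟨i, hi⟩ | ⟨x, t, hxt⟩
    · obtain ⟨g, hg, hgA⟩ := exists_strictMono_mem hi
      simp only [Finset.mem_image] at hgA
      have hgs : ∀ p, g p < s := by
        intro p
        obtain ⟨e, _, he⟩ := hgA p
        rw [← he]
        exact Nat.mod_lt _ hs
      exact ⟨(Sum.inl (i, fun p => ⟨g p, hgs p⟩), w.1 i), hW.lt w hw i, hg, rfl, hgA⟩
    · set H := (windowItems s S w).filter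
        (fun e => e.1 = x ∧ e.2.1 / s = t ∧ e.2.2 / s = t) with hH
      have hHm : ∀ e ∈ H, (e ∈ S ∧ (∀ i, e.1 i / s = w.1 i) ∧ w.2.1 ≤ e.2.1 / s ∧
          e.2.2 / s ≤ w.2.2) ∧ e.1 = x ∧ e.2.1 / s = t ∧ e.2.2 / s = t := by
        intro e he
        rw [hH, Finset.mem_filter, mem_windowItems] at he
        exact he
      have hinj : Set.InjOn (fun e : Item (D + 1) => e.2.1) H := by
        intro e he e' he' h
        by_contra hne
        have h1 := hHm e he
        have h2 := hHm e' he'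
        have h3 := hS.le e h1.1.1
        have h4 := hS.le e' h2.1.1
        simp only at h
        rcases hS.disj e h1.1.1 e' h2.1.1 hne (h1.2.1.trans h2.2.1.symm) with h | h <;> omega
      rw [← Finset.card_image_of_injOn hinj] at hxt
      obtain ⟨g, hg, hgA⟩ := exists_strictMono_mem hxt
      choose e heH heg using fun p => Finset.mem_image.1 (hgA p)
      have he := fun p => hHm (e p) (heH p)
      -- Since `k > 0`, some interval witnesses that the cell `t` lies in the window.
      have h0 := he ⟨0, hk⟩
      have ht1 : w.2.1 ≤ t := by rw [← h0.2.2.1]; exact h0.1.2.2.1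
      have ht2 : t ≤ w.2.2 := by rw [← h0.2.2.2]; exact h0.1.2.2.2
      have ha : ∀ p, t * s + (e p).2.1 % s = (e p).2.1 := by
        intro p
        conv_rhs => rw [← Nat.div_add_mod' (e p).2.1 s, (he p).2.2.1]
      have hb : ∀ p, t * s + (e p).2.2 % s = (e p).2.2 := by
        intro p
        conv_rhs => rw [← Nat.div_add_mod' (e p).2.2 s, (he p).2.2.2]
      refine ⟨(Sum.inr fun p => (⟨(e p).2.1 % s, Nat.mod_lt _ hs⟩,
        ⟨(e p).2.2 % s, Nat.mod_lt _ hs⟩), t), ht2.trans_lt (hW.snd_lt w hw), ?_, ht1, ht2,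
        x, ?_, ?_⟩
      · intro p q hpq
        simp only
        rw [hb, ha]
        have h1 := hg hpq
        rw [← heg p, ← heg q] at h1
        have hne : e p ≠ e q := fun h => by rw [h] at h1; exact lt_irrefl _ h1
        have h3 := hS.le _ (he p).1.1
        have h4 := hS.le _ (he q).1.1
        rcases hS.disj _ (he p).1.1 _ (he q).1.1 hne ((he p).2.1.trans (he q).2.1.symm)
          with h | h <;> omega
      · intro i
        rw [← h0.2.1]
        exact h0.1.2.1 i
      · intro p
        simp only
        rw [hb, ha, ← (he p).2.1]
        exact (he p).1.1
  rcases W.eq_empty_or_nonempty with rfl | ⟨w₁, hw₁⟩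
  · simp
  have : Nonempty (Γ × ℕ) := ⟨(hcol w₁ hw₁).choose⟩
  choose! col hcoln hcolP using hcol
  have hcard : ((Finset.univ : Finset Γ) ×ˢ Finset.range n).card =
      ((D + 1) * s ^ k + (s * s) ^ k) * n := by
    simp [Γ, Finset.card_product]
  rw [← hcard]
  apply Finset.card_le_mul_card_image_of_maps_to (f := col)
  · intro w hw
    simpa using hcoln w hw
  · rintro ⟨c, v⟩ _
    have hsub : IsSystem n (W.filter (fun w => col w = (c, v))) :=
      hW.subset (Finset.filter_subset _ _)
    have hfib : ∀ w ∈ W.filter (fun w => col w = (c, v)), P w (c, v) := by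
      intro w hw
      obtain ⟨h1, h2⟩ := Finset.mem_filter.1 hw
      rw [← h2]
      exact hcolP w h1
    rcases Finset.eq_empty_or_nonempty (W.filter (fun w => col w = (c, v))) with h0 | ⟨w₀, hw₀⟩
    · rw [h0]; simp
    rcases c with ⟨i, ρ⟩ | φ
    · exact card_windows_of_residues hno hsub i (hK i) v (fun p => (ρ p : ℕ)) (hfib w₀ hw₀).1
        fun w hw => (hfib w hw).2
    · exact card_windows_of_cell hno hsub hK' v (fun p => v * s + (φ p).1)
        (fun p => v * s + (φ p).2) (hfib w₀ hw₀).1 fun w hw => (hfib w hw).2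

/-! ### Induction on the dimension -/

theorem IsSystem.mono {D n m : ℕ} {S : Finset (Item D)} (hS : IsSystem n S) (h : n ≤ m) :
    IsSystem m S :=
  ⟨fun e he i => (hS.lt e he i).trans_le h, hS.le, fun e he => (hS.snd_lt e he).trans_le h,
    hS.disj⟩

/-- With no transversal direction all intervals lie on one line, and sorting them realises any `τ`.
-/
theorem hasPattern_of_le_card {k n : ℕ} {S : Finset (Item 0)} (hS : IsSystem n S)
    (σ : Fin 0 → Equiv.Perm (Fin k)) (τ : Equiv.Perm (Fin k)) (h : k ≤ S.card) :
    HasPattern S σ τ := by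
  have hdisj : ∀ e ∈ S, ∀ e' ∈ S, e ≠ e' → e.2.2 < e'.2.1 ∨ e'.2.2 < e.2.1 :=
    fun e he e' he' hne => hS.disj e he e' he' hne (Subsingleton.elim _ _)
  have hinj : Set.InjOn (fun e : Item 0 => e.2.1) S := by
    intro e he e' he' h
    by_contra hne
    have h3 := hS.le e he
    have h4 := hS.le e' he'
    simp only at h
    rcases hdisj e he e' he' hne with h | h <;> omega
  rw [← Finset.card_image_of_injOn hinj] at h
  obtain ⟨g, hg, hgA⟩ := exists_strictMono_mem h
  choose e heS heg using fun p => Finset.mem_image.1 (hgA p)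
  refine ⟨fun r => e (τ r), fun r => heS _, fun i => i.elim0, fun r r' hr => ?_⟩
  have h1 := hg hr
  rw [← heg, ← heg] at h1
  have hne : e (τ r) ≠ e (τ r') := fun h => by rw [h] at h1; exact lt_irrefl _ h1
  have h3 := hS.le _ (heS (τ r))
  have h4 := hS.le _ (heS (τ r'))
  rcases hdisj _ (heS _) _ (heS _) hne with h | h <;> omega

/-- This dictates the choice `s = (k + 2) ^ 2`; the spare unit absorbs the contribution of the thick
windows. -/
theorem contraction_factor_lt (D k : ℕ) :
    k ^ (D + 1) * (k + 2) + 1 ≤ ((k + 2) ^ 2) ^ (D + 1) := by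
  calc k ^ (D + 1) * (k + 2) + 1 ≤ (k + 1) ^ (D + 1) * (k + 2) + (k + 2) ^ (D + 1) := by
        gcongr
        · omega
        · exact Nat.one_le_pow _ _ (by omega)
    _ ≤ (k + 1) * (k + 2) ^ D * (k + 2) + (k + 2) ^ (D + 1) := by
        gcongr
        rw [pow_succ']
        gcongr
        omega
    _ = (k + 2) ^ (D + 1) * (k + 2) := by ring
    _ ≤ (k + 2) ^ (D + 1) * (k + 2) ^ (D + 1) := by
        gcongr
        exact Nat.le_self_pow (by omega) _
    _ = _ := by rw [← pow_mul, ← pow_add]; congr 1; ring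

/-- A system of intervals in the cube of side `n` and dimension `D + 1` that avoids a permutation
pattern has `O(n ^ D)` members. -/
theorem exists_card_system_le (D : ℕ) {k : ℕ} (σ : Fin D → Equiv.Perm (Fin k))
    (τ : Equiv.Perm (Fin k)) :
    ∃ K, ∀ n (S : Finset (Item D)), IsSystem n S → ¬ HasPattern S σ τ → S.card ≤ K * n ^ D := by
  induction D generalizing τ with
  | zero =>
    refine ⟨k, fun n S hS hno => ?_⟩
    by_contra hlt
    exact hno (hasPattern_of_le_card hS σ τ (by simpa using (not_le.1 hlt).le))
  | succ D ih =>
    rcases Nat.eq_zero_or_pos k with rfl | hk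
    · exact ⟨0, fun n S _ hno => absurd
        ⟨fun r => r.elim0, fun r => r.elim0, fun _ r => r.elim0, fun r => r.elim0⟩ hno⟩
    choose K₁ hK₁ using fun i : Fin (D + 1) => ih (i.removeNth σ) τ
    -- Here `σ 0` becomes the order along the lines, so the induction must allow every `τ`.
    obtain ⟨K₀, hK₀⟩ := ih (Fin.tail σ) (σ 0)
    set K := ∑ i, K₁ i + K₀ with hK
    set s := (k + 2) ^ 2 with hs
    have hspos : 0 < s := by positivity
    have hs1 : 1 < s := by rw [hs]; nlinarith
    set c := k ^ (D + 1) * (k + 2) with hc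
    set M := s ^ (D + 1) * (s + 2) with hM
    set γ := (D + 1) * s ^ k + (s * s) ^ k with hγ
    -- `C` dominates the window term, and the `+ 1` covers side `1`, where only one interval fits.
    set C := M * (K * γ) + 1 with hC
    have key : ∀ m (S : Finset (Item (D + 1))), IsSystem (s ^ m) S → ¬ HasPattern S σ τ →
        S.card ≤ C * (s ^ m) ^ (D + 1) := by
      intro m
      induction m with
      | zero =>
        intro S hS _
        have h1 : S.card ≤ 1 := by
          rw [Finset.card_le_one]
          intro e he e' he'
          by_contra hne
          have h1 := hS.snd_lt e he
          have h2 := hS.snd_lt e' he'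
          have h5 := hS.le e he
          have h6 := hS.le e' he'
          rcases hS.disj e he e' he' hne (funext fun i => by
            have h3 := hS.lt e he i
            have h4 := hS.lt e' he' i
            simp only [pow_zero] at h3 h4
            omega) with h | h <;> simp only [pow_zero] at h1 h2 <;> omega
        simp only [pow_zero, one_pow, mul_one]
        omega
      | succ m ihm =>
        intro S hS hno
        rw [pow_succ'] at hS
        obtain ⟨S', W, hS', hno', hW, hth, hcard⟩ := contract_system hspos hS hno
        have h1 := ihm S' hS' hno'
        have h2 : W.card ≤ K * (s ^ m) ^ D * (γ * s ^ m) := by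
          apply card_thick_windows_le hk hspos hS hno hW hth
          · intro i U hU hnoU
            refine (hK₁ i _ U hU hnoU).trans (Nat.mul_le_mul_right _ ?_)
            have := Finset.single_le_sum (f := K₁) (fun i _ => Nat.zero_le _) (Finset.mem_univ i)
            omega
          · intro U hU hnoU
            refine (hK₀ _ U hU hnoU).trans (Nat.mul_le_mul_right _ ?_)
            omega
        set N := s ^ m with hN
        calc S.card ≤ c * S'.card + M * W.card := hcard
          _ ≤ c * (C * N ^ (D + 1)) + M * (K * N ^ D * (γ * N)) := by gcongr
          _ = (c * C + M * (K * γ)) * N ^ (D + 1) := by ring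
          _ ≤ ((c + 1) * C) * N ^ (D + 1) := by
              apply Nat.mul_le_mul_right
              have : (c + 1) * C = c * C + C := by ring
              rw [this]
              exact Nat.add_le_add_left (Nat.le_succ _) _
          _ ≤ (s ^ (D + 1) * C) * N ^ (D + 1) := by
              gcongr
              exact contraction_factor_lt D k
          _ = C * (s ^ (m + 1)) ^ (D + 1) := by rw [pow_succ' s m, ← hN, mul_pow]; ring
    -- Rounding `n` up to a power of `s` enlarges it at most `s` times.
    refine ⟨C * s ^ (D + 1), fun n S hS hno => ?_⟩
    rcases Nat.eq_zero_or_pos n with rfl | hn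
    · have : S = ∅ := by
        by_contra hne
        obtain ⟨e, he⟩ := Finset.nonempty_iff_ne_empty.2 hne
        exact absurd (hS.snd_lt e he) (Nat.not_lt_zero _)
      simp [this]
    · have h1 := Nat.lt_pow_succ_log_self hs1 n
      have h2 := Nat.pow_log_le_self s hn.ne'
      calc S.card ≤ C * (s ^ (Nat.log s n + 1)) ^ (D + 1) := key _ S (hS.mono h1.le) hno
        _ ≤ C * (s * n) ^ (D + 1) := by
            rw [pow_succ' s]
            gcongr
        _ = _ := by rw [mul_pow]; ring

/-! ### Passage between matrices and interval systems -/

/-- Grouping the members of a finite set into consecutive runs of length `j`. -/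
theorem exists_runs {n j : ℕ} (hj : 0 < j) (B : Finset (Fin n)) :
    ∃ W : Finset (ℕ × ℕ), DisjointIntervals Prod.fst Prod.snd W ∧ B.card ≤ j * W.card + j ∧
      ∀ w ∈ W, w.1 ≤ w.2 ∧ w.2 < n ∧ ∃ h : Fin j → Fin n, StrictMono h ∧
        ∀ t, h t ∈ B ∧ w.1 ≤ h t ∧ (h t : ℕ) ≤ w.2 := by
  classical
  set f := B.orderEmbOfFin rfl with hf
  let g : ℕ → ℕ := fun t => if h : t < B.card then f ⟨t, h⟩ else 0
  have hg : ∀ t (h : t < B.card), g t = f ⟨t, h⟩ := fun t h => dif_pos h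
  have hmono : ∀ t t', t < t' → t' < B.card → g t < g t' := by
    intro t t' h h'
    rw [hg t (h.trans h'), hg t' h']
    exact f.strictMono h
  have hmono' : ∀ t t', t ≤ t' → t' < B.card → g t ≤ g t' := by
    intro t t' h h'
    rcases h.eq_or_lt with rfl | h
    · exact le_rfl
    · exact (hmono t t' h h').le
  have hend : ∀ q, q < B.card / j → q * j + j ≤ B.card := by
    intro q hq
    have := (Nat.le_div_iff_mul_le hj).1 hq
    rwa [Nat.succ_mul] at this
  have hlt : ∀ q q', q < q' → q' < B.card / j → g (q * j + (j - 1)) < g (q' * j) := by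
    intro q q' h h'
    have h1 := hend q' h'
    have h2 := Nat.mul_le_mul_right j (Nat.succ_le_of_lt h)
    rw [Nat.succ_mul] at h2
    apply hmono <;> omega
  have hle : ∀ q, q < B.card / j → g (q * j) ≤ g (q * j + (j - 1)) := by
    intro q h
    have h1 := hend q h
    apply hmono' <;> omega
  refine ⟨(Finset.range (B.card / j)).image (fun q => (g (q * j), g (q * j + (j - 1)))),
    ?_, ?_, ?_⟩
  · intro w hw w' hw' hne
    obtain ⟨q, hq, rfl⟩ := Finset.mem_image.1 hw
    obtain ⟨q', hq', rfl⟩ := Finset.mem_image.1 hw'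
    rw [Finset.mem_range] at hq hq'
    rcases lt_trichotomy q q' with h | rfl | h
    · exact Or.inl (hlt q q' h hq')
    · exact absurd rfl hne
    · exact Or.inr (hlt q' q h hq)
  · rw [Finset.card_image_of_injOn, Finset.card_range]
    · have h1 := Nat.div_add_mod B.card j
      have h2 := Nat.mod_lt B.card hj
      omega
    · intro q hq q' hq' h
      simp only [Finset.coe_range, Set.mem_Iio] at hq hq'
      rw [Prod.mk.injEq] at h
      have h1 := hle q hq
      have h2 := hle q' hq'
      rcases lt_trichotomy q q' with h' | rfl | h'
      · have := hlt q q' h' hq'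
        omega
      · rfl
      · have := hlt q' q h' hq
        omega
  · intro w hw
    obtain ⟨q, hq, rfl⟩ := Finset.mem_image.1 hw
    rw [Finset.mem_range] at hq
    have h1 := hend q hq
    refine ⟨hle q hq, ?_, fun t => f ⟨q * j + t, by omega⟩, ?_, ?_⟩
    · simp only
      rw [hg _ (by omega)]
      exact Fin.is_lt _
    · intro t t' h
      apply f.strictMono
      simpa using h
    · intro t
      refine ⟨B.orderEmbOfFin_mem rfl _, ?_, ?_⟩
      · rw [← hg (q * j + t) (by omega)]
        apply hmono' <;> omega
      · rw [← hg (q * j + t) (by omega)]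
        apply hmono' <;> omega

/-- The ones of `A` on the line in direction `l` with transversal coordinates `x`. -/
def lineOnes {D n : ℕ} (A : Cube n (D + 1)) (l : Fin (D + 1)) (x : Fin D → Fin n) :
    Finset (Fin n) :=
  Finset.univ.filter (fun c => A (l.insertNth c x) = true)

theorem ones_eq_sum_lineOnes {D n : ℕ} (A : Cube n (D + 1)) (l : Fin (D + 1)) :
    ones A = ∑ x, (lineOnes A l x).card := by
  classical
  simp only [ones, lineOnes, Finset.card_filter]
  rw [← (Fin.insertNthEquiv (fun _ => Fin n) l).sum_comp, Fintype.sum_prod_type_right]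
  rfl

/-- The runs of `j` ones on the lines in direction `l` form a system of intervals. -/
theorem exists_run_system {D n j : ℕ} (hj : 0 < j) (A : Cube n (D + 1)) (l : Fin (D + 1)) :
    ∃ S : Finset (Item D), IsSystem n S ∧ ones A ≤ j * S.card + j * n ^ D ∧
      ∀ e ∈ S, ∃ (x : Fin D → Fin n) (h : Fin j → Fin n), (∀ i, e.1 i = x i) ∧ StrictMono h ∧
        ∀ t, A (l.insertNth (h t) x) = true ∧ e.2.1 ≤ h t ∧ (h t : ℕ) ≤ e.2.2 := by
  classical
  choose W hWd hWc hW using fun x => exists_runs hj (lineOnes A l x)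
  have hval : Function.Injective (fun (x : Fin D → Fin n) i => (x i : ℕ)) :=
    fun x y h => funext fun i => Fin.ext (congrFun h i)
  refine ⟨Finset.univ.biUnion fun x => (W x).image (fun w => ((fun i => (x i : ℕ)), w)),
    ?_, ?_, ?_⟩
  · constructor
    · intro e he i
      simp only [Finset.mem_biUnion, Finset.mem_image] at he
      obtain ⟨x, -, w, hw, rfl⟩ := he
      exact (x i).is_lt
    · intro e he
      simp only [Finset.mem_biUnion, Finset.mem_image] at he
      obtain ⟨x, -, w, hw, rfl⟩ := he
      exact (hW x w hw).1
    · intro e he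
      simp only [Finset.mem_biUnion, Finset.mem_image] at he
      obtain ⟨x, -, w, hw, rfl⟩ := he
      exact (hW x w hw).2.1
    · intro e he e' he' hne h
      simp only [Finset.mem_biUnion, Finset.mem_image] at he he'
      obtain ⟨x, -, w, hw, rfl⟩ := he
      obtain ⟨x', -, w', hw', rfl⟩ := he'
      obtain rfl : x = x' := hval h
      exact hWd x w hw w' hw' (fun h => hne (by rw [h]))
  · rw [Finset.card_biUnion, ones_eq_sum_lineOnes A l]
    · calc ∑ x, (lineOnes A l x).card ≤ ∑ x, (j * (W x).card + j) :=
            Finset.sum_le_sum fun x _ => hWc x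
        _ = _ := by
            rw [Finset.sum_add_distrib, Finset.mul_sum]
            congr 1
            · refine Finset.sum_congr rfl fun x _ => ?_
              rw [Finset.card_image_of_injective _ (Prod.mk_right_injective _)]
            · simp [mul_comm]
    · intro x _ y _ hne
      simp only [Function.onFun, Finset.disjoint_left, Finset.mem_image, not_exists, not_and]
      rintro _ ⟨w, _, rfl⟩ w' _ h
      exact hne (hval (congrArg Prod.fst h)).symm
  · intro e he
    simp only [Finset.mem_biUnion, Finset.mem_image] at he
    obtain ⟨x, -, w, hw, rfl⟩ := he
    obtain ⟨_, _, h, hh, hB⟩ := hW x w hw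
    refine ⟨x, h, fun i => rfl, hh, fun t => ⟨?_, (hB t).2⟩⟩
    simpa [lineOnes] using (hB t).1

/-- The ones of a permutation matrix, numbered by their coordinate `l`, are described by
permutations in the other directions. -/
theorem IsPermutation.exists_perm {D k : ℕ} {P : Cube k (D + 1)} (hP : IsPermutation P)
    (l : Fin (D + 1)) :
    ∃ σ : Fin D → Equiv.Perm (Fin k), ∀ p, P p = true → ∀ i, p (l.succAbove i) = σ i (p l) := by
  choose q hq hqu using hP l
  simp only at hq hqu
  -- Ones sharing a coordinate in another direction coincide.
  have hinj : ∀ i, Function.Injective (fun r => q r (l.succAbove i)) := by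
    intro i r r' h
    have := (hP (l.succAbove i) (q r (l.succAbove i))).unique ⟨rfl, (hq r).2⟩
      ⟨h.symm, (hq r').2⟩
    rw [← (hq r).1, ← (hq r').1, this]
  refine ⟨fun i => Equiv.ofBijective _ (Finite.injective_iff_bijective.1 (hinj i)),
    fun p hp i => ?_⟩
  have := hqu (p l) p ⟨rfl, hp⟩
  simp only [Equiv.ofBijective_apply]
  rw [← this]

theorem divNat_lt_or_modNat_lt {k t : ℕ} {a b : Fin (k * t)} (h : a < b) :
    a.divNat < b.divNat ∨ a.divNat = b.divNat ∧ a.modNat < b.modNat := by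
  rcases lt_or_ge a.divNat b.divNat with h1 | h1
  · exact Or.inl h1
  · have h2 : a.divNat = b.divNat := le_antisymm (Nat.div_le_div_right h.le) h1
    refine Or.inr ⟨h2, ?_⟩
    have h3 : (a : ℕ) / t = b / t := congrArg Fin.val h2
    have h4 := Nat.div_add_mod (a : ℕ) t
    have h5 := Nat.div_add_mod (b : ℕ) t
    rw [h3] at h4
    have h6 : (a : ℕ) < b := h
    change (a : ℕ) % t < b % t
    omega

/-- The `j` copies of a one of `P` go to the `j` ones in the corresponding interval. Numbering the
ones by coordinate `l` makes the order along the lines the identity. -/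
theorem contains_tupleMat_of_hasPattern {D n k j : ℕ} (hj : 0 < j) {A : Cube n (D + 1)}
    {l : Fin (D + 1)} {S : Finset (Item D)}
    (hS : ∀ e ∈ S, ∃ (x : Fin D → Fin n) (h : Fin j → Fin n), (∀ i, e.1 i = x i) ∧ StrictMono h ∧
        ∀ t, A (l.insertNth (h t) x) = true ∧ e.2.1 ≤ h t ∧ (h t : ℕ) ≤ e.2.2)
    {P : Cube k (D + 1)} {σ : Fin D → Equiv.Perm (Fin k)}
    (hσ : ∀ p, P p = true → ∀ i, p (l.succAbove i) = σ i (p l))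
    (hpat : HasPattern S σ (Equiv.refl _)) : Contains A (tupleMat P j l) := by
  obtain ⟨f, hfS, hfσ, hfτ⟩ := hpat
  choose x h hx hh hA using fun r => hS (f r) (hfS r)
  have hle : ∀ i, tupleSize j l i ≤ j := by
    intro i
    unfold tupleSize
    split_ifs <;> omega
  -- In direction `l` this is the `t`-th one of run `c`; in another direction, the coordinate of the
  -- line whose rank there is `c`.
  let pos : Fin (D + 1) → Fin k → Fin j → Fin n :=
    l.insertNth (α := fun _ => Fin k → Fin j → Fin n) h (fun i c _ => x ((σ i).symm c) i)
  have hpos : ∀ r t, pos l r t = h r t := by intro r t; simp [pos]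
  have hpos' : ∀ i r t, pos (l.succAbove i) r t = x ((σ i).symm r) i := by
    intro i r t; simp [pos]
  have hmono : ∀ i, StrictMono (fun q : Fin (k * tupleSize j l i) =>
      pos i q.divNat (Fin.castLE (hle i) q.modNat)) := by
    intro i a b hab
    simp only
    rcases Fin.eq_self_or_eq_succAbove l i with rfl | ⟨i, rfl⟩
    · rw [hpos, hpos]
      rcases divNat_lt_or_modNat_lt hab with h1 | ⟨h1, h2⟩
      · have := hfτ _ _ h1
        exact Fin.lt_def.2 (((hA _ _).2.2.trans_lt this).trans_le (hA _ _).2.1)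
      · rw [h1]
        exact hh _ h2
    · rw [hpos', hpos']
      rcases divNat_lt_or_modNat_lt hab with h1 | ⟨h1, h2⟩
      · have := hfσ i ((σ i).symm a.divNat) ((σ i).symm b.divNat) (by simpa using h1)
        rw [hx, hx] at this
        exact this
      · have h3 : tupleSize j l (l.succAbove i) = 1 := if_neg (Fin.succAbove_ne l i)
        have h4 := b.modNat.is_lt
        have h5 : (a.modNat : ℕ) < b.modNat := h2
        omega
  refine ⟨fun i => OrderEmbedding.ofStrictMono _ (hmono i), fun q hq => ?_⟩
  · simp only [tupleMat, kron, allOnes, Bool.and_true] at hq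
    have hp := hσ _ hq
    convert (hA (q l).divNat (Fin.castLE (hle l) (q l).modNat)).1 using 2
    funext i
    change pos i (q i).divNat (Fin.castLE (hle i) (q i).modNat) = _
    rcases Fin.eq_self_or_eq_succAbove l i with rfl | ⟨i, rfl⟩
    · rw [hpos, Fin.insertNth_apply_same]
    · rw [hpos', Fin.insertNth_apply_succAbove, hp i, Equiv.symm_apply_apply]

/-! ### Bounds for the extremal functions -/

/-- Upper bound for the extremal function of a tuple permutation matrix. -/
theorem exists_extremal_tupleMat_le {D k j : ℕ} (hj : 0 < j) {P : Cube k (D + 1)}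
    (hP : IsPermutation P) (l : Fin (D + 1)) :
    ∃ K, ∀ n, extremal n (tupleMat P j l) ≤ K * n ^ D := by
  classical
  obtain ⟨σ, hσ⟩ := hP.exists_perm l
  obtain ⟨K, hK⟩ := exists_card_system_le D σ (Equiv.refl _)
  refine ⟨j * K + j, fun n => Finset.sup_le fun A hA => ?_⟩
  have hav : Avoids A (tupleMat P j l) := (Finset.mem_filter.1 hA).2
  obtain ⟨S, hS, hc, hrun⟩ := exists_run_system hj A l
  have h1 := hK n S hS fun hpat => hav (contains_tupleMat_of_hasPattern hj hrun hσ hpat)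
  calc ones A ≤ j * S.card + j * n ^ D := hc
    _ ≤ j * (K * n ^ D) + j * n ^ D := by gcongr
    _ = _ := by ring

/-- Lower bound for the extremal function: a hyperplane of ones avoids every matrix with two ones
that differ in the coordinate orthogonal to the hyperplane. -/
theorem pow_le_extremal {D : ℕ} {p : Fin (D + 1) → ℕ} {N : Mat p} (hN : 2 ≤ ones N) {n : ℕ}
    (hn : 1 ≤ n) : n ^ D ≤ extremal n N := by
  classical
  obtain ⟨u, hu, v, hv, huv⟩ := Finset.one_lt_card.1 (show 1 < ones N from hN)
  simp only [Finset.mem_filter, Finset.mem_univ, true_and] at hu hv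
  obtain ⟨l, hl⟩ := Function.ne_iff.1 huv
  let z : Fin n := ⟨0, hn⟩
  let A : Cube n (D + 1) := fun i => decide (i l = z)
  have hav : Avoids A N := by
    rintro ⟨e, he⟩
    have h1 := he u hu
    have h2 := he v hv
    simp only [A, decide_eq_true_eq] at h1 h2
    exact hl ((e l).injective (h1.trans h2.symm))
  have hones : ones A = n ^ D := by
    rw [ones_eq_sum_lineOnes A l]
    simp [lineOnes, A, Finset.filter_eq']
  rw [← hones]
  exact Finset.le_sup (f := ones) (Finset.mem_filter.2 ⟨Finset.mem_univ A, hav⟩)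

/-- A single one of `P` already yields `j` ones, which differ in direction `l`. -/
theorem two_le_ones_tupleMat {D k j : ℕ} (hj : 2 ≤ j) (hk : 1 ≤ k) {P : Cube k (D + 1)}
    (hP : IsPermutation P) (l : Fin (D + 1)) : 2 ≤ ones (tupleMat P j l) := by
  classical
  obtain ⟨p, ⟨_, hp⟩, _⟩ := hP l ⟨0, hk⟩
  have hpos : ∀ i, 0 < tupleSize j l i := by
    intro i
    unfold tupleSize
    split_ifs <;> omega
  have hl : tupleSize j l l = j := if_pos rfl
  let pt : (t : (i : Fin (D + 1)) → Fin (tupleSize j l i)) →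
      (i : Fin (D + 1)) → Fin (k * tupleSize j l i) := fun t i => finProdFinEquiv (p i, t i)
  have hdiv : ∀ t i, (pt t i).divNat = p i := fun t i =>
    congrArg Prod.fst (finProdFinEquiv.symm_apply_apply (p i, t i))
  have hmod : ∀ t i, (pt t i).modNat = t i := fun t i =>
    congrArg Prod.snd (finProdFinEquiv.symm_apply_apply (p i, t i))
  let t₀ : (i : Fin (D + 1)) → Fin (tupleSize j l i) := fun i => ⟨0, hpos i⟩
  let t₁ := Function.update t₀ l ⟨1, by omega⟩
  have hmem : ∀ t, tupleMat P j l (pt t) = true := by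
    intro t
    simp only [tupleMat, kron, allOnes, Bool.and_true, hdiv]
    exact hp
  refine Finset.one_lt_card.2 ⟨pt t₀, by simpa using hmem t₀, pt t₁, by simpa using hmem t₁, ?_⟩
  intro h
  have h1 := hmod t₀ l
  rw [h, hmod] at h1
  simp [t₁, t₀] at h1

/-- The main diagonal serves; this keeps the maximum defining `maxExtremal` from being over an empty
set. -/
theorem exists_isPermutation (k D : ℕ) : ∃ P : Cube k (D + 1), IsPermutation P := by
  refine ⟨fun i => decide (∀ l, i l = i 0), fun l c => ⟨fun _ => c, by simp, ?_⟩⟩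
  rintro i ⟨hl, hi⟩
  simp only [decide_eq_true_eq] at hi
  funext m
  rw [hi m, ← hi l, hl]

/-- There are finitely many pairs `(P, l)`, so the sum of their constants is uniform. -/
theorem exists_maxExtremal_le {D k j : ℕ} (hj : 0 < j) :
    ∃ K, ∀ n, maxExtremal n j k (D + 1) ≤ K * n ^ D := by
  classical
  have hbd : ∀ x : Cube k (D + 1) × Fin (D + 1), ∃ K, IsPermutation x.1 →
      ∀ n, extremal n (tupleMat x.1 j x.2) ≤ K * n ^ D := by
    intro x
    by_cases hP : IsPermutation x.1
    · obtain ⟨K, hK⟩ := exists_extremal_tupleMat_le hj hP x.2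
      exact ⟨K, fun _ => hK⟩
    · exact ⟨0, fun h => absurd h hP⟩
  choose K hK using hbd
  refine ⟨∑ x, K x, fun n => ?_⟩
  unfold maxExtremal
  refine Finset.sup_le fun x hx => ?_
  rw [Finset.mem_filter] at hx
  exact (hK x hx.2 n).trans (Nat.mul_le_mul_right _
    (Finset.single_le_sum (f := K) (fun _ _ => Nat.zero_le _) (Finset.mem_univ x)))

theorem pow_le_maxExtremal {D k j n : ℕ} (hj : 2 ≤ j) (hk : 1 ≤ k) (hn : 1 ≤ n) :
    n ^ D ≤ maxExtremal n j k (D + 1) := by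
  classical
  obtain ⟨P, hP⟩ := exists_isPermutation k D
  have h1 := pow_le_extremal (two_le_ones_tupleMat hj hk hP 0) hn
  unfold maxExtremal
  refine le_trans h1 (Finset.le_sup (b := (P, 0))
    (f := fun x : Cube k (D + 1) × Fin (D + 1) => extremal n (tupleMat x.1 j x.2)) ?_)
  rw [Finset.mem_filter]
  exact ⟨Finset.mem_univ _, hP⟩

theorem isTheta_of_le_of_le {D K : ℕ} {u : ℕ → ℕ} (hu : ∀ n, u n ≤ K * n ^ D)
    (hl : ∀ n, 1 ≤ n → n ^ D ≤ u n) :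
    (fun n : ℕ => (u n : ℝ)) =Θ[Filter.atTop] (fun n : ℕ => (n : ℝ) ^ D) := by
  constructor
  · refine Asymptotics.IsBigO.of_bound K (Filter.Eventually.of_forall fun n => ?_)
    rw [Real.norm_of_nonneg (by positivity), Real.norm_of_nonneg (by positivity)]
    exact_mod_cast hu n
  · refine Asymptotics.IsBigO.of_bound 1 ((Filter.eventually_ge_atTop 1).mono fun n hn => ?_)
    rw [Real.norm_of_nonneg (by positivity), Real.norm_of_nonneg (by positivity), one_mul]
    exact_mod_cast hl n hn

end ZeroOne

theorem theorem3p1 (j k d : ℕ) (hj : 2 ≤ j) (hk : 1 ≤ k) (hd : 1 ≤ d) :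
    ((fun n : ℕ => (ZeroOne.maxExtremal n j k d : ℝ)) =Θ[Filter.atTop]
      (fun n : ℕ => (n : ℝ) ^ (d - 1))) ∧
    (∀ P : ZeroOne.Cube k d, ZeroOne.IsPermutation P → ∀ l : Fin d,
      (fun n : ℕ => (ZeroOne.extremal n (ZeroOne.tupleMat P j l) : ℝ)) =Θ[Filter.atTop]
        (fun n : ℕ => (n : ℝ) ^ (d - 1))) ∧
    (∀ (p : Fin d → ℕ) (N : ZeroOne.Mat p), 2 ≤ ZeroOne.ones N →
      ∀ n : ℕ, 1 ≤ n → n ^ (d - 1) ≤ ZeroOne.extremal n N) := by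
  obtain ⟨D, rfl⟩ : ∃ D, d = D + 1 := ⟨d - 1, by omega⟩
  rw [Nat.add_sub_cancel]
  have hj0 : 0 < j := by omega
  refine ⟨?_, fun P hP l => ?_, fun p N hN n hn => ZeroOne.pow_le_extremal hN hn⟩
  · obtain ⟨K, hK⟩ := ZeroOne.exists_maxExtremal_le (k := k) (D := D) hj0
    exact ZeroOne.isTheta_of_le_of_le hK fun n hn => ZeroOne.pow_le_maxExtremal hj hk hn
  · obtain ⟨K, hK⟩ := ZeroOne.exists_extremal_tupleMat_le hj0 hP l
    exact ZeroOne.isTheta_of_le_of_le hK fun n hn =>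
      ZeroOne.pow_le_extremal (ZeroOne.two_le_ones_tupleMat hj hk hP l) hn
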